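/- For a complex number $a$ with $\Re(a)>1$ and $x\in[0,1]$ let \[\zeta_1(a,x)=\sum_{k=1}^\infty \frac{1}{(k+x)^a},\] so that $\zeta_1(a,x)=\zeta(a,x)-x^{-a}$ for $0<x\le 1$, where $\zeta(a,x)$ is the Hurwitz zeta function. Let $\zeta$ be the Riemann zeta function, $\zeta'$ its derivative, $\Gamma$ the Euler gamma function, $\psi=\Gamma'/\Gamma$ its logarithmic derivative, and $(a)_n=a(a+1)\cdots(a+n-1)$ the Pochhammer symbol, with $(a)_0=1$. Then for every integer $m\ge 2$ \[ \int_0^1\zeta_1(m,x)\,\zeta_1(m,1-x)\,dx =\frac{2\Gamma(2m-1)}{\Gamma(m)^2}\Big\{[\psi(m)-\psi(2m-1)]\,[\zeta(2m-1)-1]-\zeta'(2m-1)\Big\} -2\sum_{\substack{n\ge 0\\ n\ne m-1}}\frac{(m)_n}{n!}\,\frac{\zeta(n+m)-1}{n+1-m}, \] where the integrand is integrable on $[0,1]$ and the series converges absolutely. -/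

import Mathlib

open scoped Nat

/-- The auxiliary Hurwitz zeta function `ζ₁(a, x) = ζ(a, x) - x ^ (-a)` for `x ∈ [0, 1]`, where
`ζ(a, x)` is the Hurwitz zeta function. (Mathlib's `hurwitzZeta` takes its parameter modulo `1`
and agrees with `ζ(a, x)` for `0 < x ≤ 1`; at `x = 0` the formula gives `ζ₁(a, 0) = ζ(a)`, because
the singular term is dropped from both sides. See `hasSum_auxHurwitzZeta`.) -/
noncomputable def auxHurwitzZeta (a : ℂ) (x : ℝ) : ℂ :=
  HurwitzZeta.hurwitzZeta (x : UnitAddCircle) a - (x : ℂ) ^ (-a)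

/-- For `Re a > 1` and `x ∈ [0, 1]`, `ζ₁(a, x) = ∑_{k ≥ 1} (k + x) ^ (-a)`. -/
theorem hasSum_auxHurwitzZeta {a : ℂ} (ha : 1 < a.re) {x : ℝ} (hx : x ∈ Set.Icc (0 : ℝ) 1) :
    HasSum (fun k : ℕ => 1 / (((k + 1 : ℕ) : ℂ) + (x : ℂ)) ^ a) (auxHurwitzZeta a x) := by
  have h := HurwitzZeta.hasSum_hurwitzZeta_of_one_lt_re hx ha
  rw [← hasSum_nat_add_iff' 1] at h
  simpa [auxHurwitzZeta, Complex.cpow_neg] using h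

/-- The term of index `n` of the primed sum
`∑' (m)ₙ / n! * (ζ(n + m) - 1) / (n + 1 - m)`, in which the term `n = m - 1` is omitted;
`(m)ₙ = m (m + 1) ⋯ (m + n - 1)` is the Pochhammer symbol. -/
noncomputable def primedTerm (m n : ℕ) : ℂ :=
  if n + 1 = m then 0
  else (ascPochhammer ℂ n).eval (m : ℂ) / (n ! : ℂ) *
    ((riemannZeta ((n : ℂ) + (m : ℂ)) - 1) / ((n : ℂ) + 1 - (m : ℂ)))

/-!
The integrand is a double series, absolutely convergent uniformly on `[0, 1]`, so it may be
integrated termwise. Write `m = q + 1`. In the term `(j + x) ^ (-m) * (k + 1 - x) ^ (-m)` with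
`j, k ≥ 1`, put `u = j + x` and `N = j + k + 1`; for fixed `N` the pieces fit together, and the
integral becomes `∑ N ≥ 3, ∫ u in 1..N - 1, (u (N - u)) ^ (-m)` (`hasSum_integral_inv_pow`).

By symmetry each integral is twice the one over `[1, N / 2]`, where `(N - u) ^ (-m)` is expanded in
powers of `u / N` and integrated termwise. The lower limit contributes powers `N ^ (-(m + n))`
with the coefficients of the primed sum. The upper limit and the logarithmic term of index
`n = m - 1` contribute `C(2q, q) N ^ (1 - 2m) (log N + c)`, with a constant `c` that does not depend
on `N` (`integral_inv_pow_eq`). To identify it as `c = H_q - H_{2q} = ψ(m) - ψ(2m - 1)`, a series at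
ratio `1 / 2` is summed by induction on `q` (`hasSum_antiderivCoeff_half`).

Summing over `N ≥ 2` (the summand `N = 2` is zero) and exchanging the two sums turns the powers of
`N` into `ζ(n + m) - 1` and `ζ(2m - 1) - 1`, and the logarithms into `-ζ'(2m - 1)`
(`integral_tsum_mul_tsum`).
-/

/-! ### The antiderivative at `1 / 2` -/

/-- The coefficient `C(n + q, q) / (n - q)` of `t ^ (n - q)` in the antiderivative
`C(2q, q) log t + ∑ n, antiderivCoeff q n * t ^ (n - q)` of `(t (1 - t)) ^ (-(q + 1))` whose Laurent
part has no constant term. The index `n = q`, which produces the logarithm, gets coefficient `0`. -/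
noncomputable def antiderivCoeff (q n : ℕ) : ℝ :=
  if n = q then 0 else ((n + q).choose q : ℝ) / ((n : ℝ) - q)

theorem antiderivCoeff_self (q : ℕ) : antiderivCoeff q q = 0 := by simp [antiderivCoeff]

theorem antiderivCoeff_of_ne {q n : ℕ} (h : n ≠ q) :
    antiderivCoeff q n = ((n + q).choose q : ℝ) / ((n : ℝ) - q) := by simp [antiderivCoeff, h]

theorem choose_add_one_mul (q n : ℕ) :
    ((n + 1 + q).choose q : ℝ) * (n + 1) = (n + q + 1) * ((n + q).choose q : ℝ) := by
  have h := Nat.choose_mul_succ_eq (n + q) q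
  rw [show n + q + 1 - q = n + 1 by omega, show n + q + 1 = n + 1 + q by ring] at h
  have h' : (((n + q).choose q * (n + 1 + q) : ℕ) : ℝ)
      = (((n + 1 + q).choose q * (n + 1) : ℕ) : ℝ) := congrArg _ h
  push_cast at h'
  linarith

theorem choose_succ_succ_mul (q n : ℕ) :
    ((n + 1 + (q + 1)).choose (q + 1) : ℝ) * (q + 1) = (n + q + 2) * ((n + 1 + q).choose q : ℝ) := by
  have h := Nat.add_one_mul_choose_eq (n + 1 + q) q
  have h' : (((n + 1 + q + 1) * (n + 1 + q).choose q : ℕ) : ℝ)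
      = (((n + 1 + q + 1).choose (q + 1) * (q + 1) : ℕ) : ℝ) := congrArg _ h
  push_cast at h'
  rw [show n + 1 + (q + 1) = n + 1 + q + 1 by ring]
  linarith

/-- The coefficient form of
`(q + 1) w ^ (-(q + 2)) = (4 q + 2) w ^ (-(q + 1)) - d/dt [(1 - 2 t) w ^ (-(q + 1))]`, where
`w = t (1 - t)`. -/
theorem antiderivCoeff_succ_succ {q n : ℕ} (h : n ≠ q) :
    (q + 1) * antiderivCoeff (q + 1) (n + 1) = (4 * q + 2) * antiderivCoeff q n
      - (((n + 1 + q).choose q : ℝ) - 2 * ((n + q).choose q : ℝ)) := by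
  rw [antiderivCoeff_of_ne h, antiderivCoeff_of_ne (by omega : n + 1 ≠ q + 1)]
  have h1 := choose_add_one_mul q n
  have h2 := choose_succ_succ_mul q n
  have hd : (n : ℝ) - q ≠ 0 := sub_ne_zero.2 (by exact_mod_cast h)
  rw [show ((n + 1 : ℕ) : ℝ) - ((q + 1 : ℕ) : ℝ) = n - q by push_cast; ring]
  field_simp
  linear_combination h2 + 2 * h1

theorem abs_antiderivCoeff_le (q n : ℕ) : |antiderivCoeff q n| ≤ ((n + q).choose q : ℝ) := by
  rcases eq_or_ne n q with rfl | h
  · simp [antiderivCoeff_self]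
  · rw [antiderivCoeff_of_ne h, abs_div, Nat.abs_cast]
    apply div_le_self (by positivity)
    have : (1 : ℤ) ≤ |(n : ℤ) - q| := Int.one_le_abs (sub_ne_zero.2 (by exact_mod_cast h))
    exact_mod_cast this

theorem summable_choose_mul_half_pow (q : ℕ) :
    Summable fun n : ℕ => ((n + q).choose q : ℝ) * (1 / 2) ^ n :=
  (hasSum_choose_mul_geometric_of_norm_lt_one q (by norm_num : ‖(1 / 2 : ℝ)‖ < 1)).summable

/-- The value at `t = 1 / 2` of the Laurent part of the antiderivative of
`(t (1 - t)) ^ (-(q + 1))`. Since `1 - 2 t` vanishes at `1 / 2`, the last term of the recurrence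
`antiderivCoeff_succ_succ` telescopes there, and only the omitted index `n = q` and the index `0`
of the next sum contribute. -/
theorem hasSum_antiderivCoeff_half (q : ℕ) :
    HasSum (fun n => antiderivCoeff q n * ((1 / 2) ^ n * 2 ^ q))
      (q.centralBinom * (Real.log 2 - ((harmonic (2 * q) : ℝ) - (harmonic q : ℝ)))) := by
  induction q with
  | zero =>
    have h := Real.hasSum_pow_div_log_of_abs_lt_one (x := 1 / 2) (by norm_num [abs_of_pos])
    rw [show -Real.log (1 - 1 / 2) = Real.log 2 by
      rw [show (1 - 1 / 2 : ℝ) = 2⁻¹ by norm_num, Real.log_inv, neg_neg]] at h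
    rw [← hasSum_nat_add_iff' 1]
    simp only [antiderivCoeff_self, Finset.sum_range_one]
    convert! h using 1
    · ext n
      rw [antiderivCoeff_of_ne (by omega)]
      simp
      ring
    · simp
  | succ q ih =>
    set g : ℕ → ℝ := fun n => ((n + q).choose q : ℝ) * ((1 / 2) ^ n * 2 ^ (q + 1)) with hg
    have hgs : Summable g := by
      simpa [hg, mul_assoc] using (summable_choose_mul_half_pow q).mul_right (2 ^ (q + 1))
    -- `g n` is the term of index `n` in the expansion of `(1 - t) ^ (-(q + 1))` at `t = 1 / 2`,
    -- scaled so that the last term of the recurrence becomes `g (n + 1) - g n`.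
    have htel : HasSum (fun n => g (n + 1) - g n) (-g 0) := by
      have h1 := (hasSum_nat_add_iff' 1).2 hgs.hasSum
      convert! h1.sub hgs.hasSum using 1
      simp
    have hq : HasSum (fun n => if n = q then g (q + 1) - g q else 0) (g (q + 1) - g q) :=
      hasSum_ite_eq q _
    have hsum := ((ih.mul_left (4 * (q : ℝ) + 2)).sub htel).add hq
    have hb : g (q + 1) - g q = - q.centralBinom / (q + 1) := by
      have h1 := choose_add_one_mul q q
      have h2 : ((q + q).choose q : ℝ) = q.centralBinom := by
        rw [Nat.centralBinom, two_mul]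
      have h3 : ((1 : ℝ) / 2) ^ q * 2 ^ q = 1 := by rw [← mul_pow]; norm_num
      have h4 : g (q + 1) - g q = ((q + 1 + q).choose q - 2 * ((q + q).choose q : ℝ))
          * ((1 / 2) ^ q * 2 ^ q) := by
        simp only [hg]; ring
      rw [h4, h3, h2]
      rw [h2] at h1
      have : (q : ℝ) + 1 ≠ 0 := by positivity
      field_simp
      linear_combination h1
    -- The recurrence relates index `n + 1` at level `q + 1` to index `n` at level `q`, so the
    -- term of index `0` at level `q + 1` is split off.
    rw [← hasSum_nat_add_iff' 1]
    have hq1 : (q : ℝ) + 1 ≠ 0 := by positivity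
    convert! hsum.mul_left ((q : ℝ) + 1)⁻¹ using 1
    · ext n
      rw [eq_inv_mul_iff_mul_eq₀ hq1]
      split_ifs with h
      · subst h
        simp [antiderivCoeff_self]
      · have := antiderivCoeff_succ_succ h
        simp only [hg]
        linear_combination (((1 : ℝ) / 2) ^ (n + 1) * 2 ^ (q + 1)) * this
    · have hc : ((q + 1).centralBinom : ℝ) = 2 * (2 * q + 1) * q.centralBinom / (q + 1) := by
        rw [eq_div_iff hq1]
        have := Nat.succ_mul_centralBinom_succ q
        have h' : (((q + 1) * (q + 1).centralBinom : ℕ) : ℝ)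
          = ((2 * (2 * q + 1) * q.centralBinom : ℕ) : ℝ) := congrArg _ this
        push_cast at h'
        linarith
      have hg0 : g 0 = 2 ^ (q + 1) := by simp [hg]
      rw [hb, hg0, hc, show 2 * (q + 1) = 2 * q + 1 + 1 by ring]
      simp only [harmonic_succ, Finset.sum_range_one]
      have he : antiderivCoeff (q + 1) 0 = -1 / (q + 1) := by
        rw [antiderivCoeff_of_ne (by omega)]
        simp only [zero_add, Nat.choose_self, Nat.cast_zero, zero_sub]
        push_cast
        rw [div_neg, neg_div]
      rw [he]
      have h21 : (2 * (q : ℝ) + 1) ≠ 0 := by positivity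
      have h22 : (2 * (q : ℝ) + 1 + 1) ≠ 0 := by positivity
      simp
      field_simp
      ring

/-! ### The integral of `(u (N - u)) ^ (-(q + 1))` -/

theorem integral_choose_mul_pow {N : ℝ} (hN : 2 ≤ N) (q n : ℕ) :
    ∫ u in (1 : ℝ)..N / 2, ((n + q).choose q : ℝ) * (u / N) ^ n * (N ^ (q + 1))⁻¹ * (u ^ (q + 1))⁻¹
      = antiderivCoeff q n * ((1 / 2) ^ n * 2 ^ q) * (N ^ (2 * q + 1))⁻¹
        - antiderivCoeff q n * (N ^ (q + 1 + n))⁻¹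
        + if n = q then q.centralBinom * (N ^ (2 * q + 1))⁻¹ * Real.log (N / 2) else 0 := by
  have hN0 : (0 : ℝ) < N := by linarith
  have h0 : (0 : ℝ) ∉ Set.uIcc 1 (N / 2) := by
    rw [Set.uIcc_of_le (by linarith)]
    intro h; linarith [h.1]
  have hcongr : ∫ u in (1 : ℝ)..N / 2,
      ((n + q).choose q : ℝ) * (u / N) ^ n * (N ^ (q + 1))⁻¹ * (u ^ (q + 1))⁻¹
      = ∫ u in (1 : ℝ)..N / 2,
        (((n + q).choose q : ℝ) * (N ^ (q + 1 + n))⁻¹) * u ^ ((n : ℤ) - (q + 1 : ℕ)) := by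
    refine intervalIntegral.integral_congr fun u hu => ?_
    have hu0 : u ≠ 0 := fun h => h0 (h ▸ hu)
    rw [zpow_sub₀ hu0, zpow_natCast, zpow_natCast, div_pow, pow_add N (q + 1) n]
    field_simp
  rw [hcongr, intervalIntegral.integral_const_mul]
  rcases eq_or_ne n q with rfl | h
  · rw [antiderivCoeff_self, if_pos rfl, show (n : ℤ) - (n + 1 : ℕ) = -1 by push_cast; ring]
    simp only [zpow_neg_one]
    rw [integral_inv h0, Nat.centralBinom, ← two_mul, show n + 1 + n = 2 * n + 1 by ring]
    simp
  · have hne : (n : ℤ) - (q + 1 : ℕ) ≠ -1 := by omega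
    rw [integral_zpow (Or.inr ⟨hne, h0⟩), if_neg h, antiderivCoeff_of_ne h]
    have hd : (n : ℝ) - q ≠ 0 := sub_ne_zero.2 (by exact_mod_cast h)
    rw [show (n : ℤ) - (q + 1 : ℕ) + 1 = n - q by push_cast; ring, one_zpow,
      zpow_sub₀ (by positivity), zpow_natCast, zpow_natCast]
    have : (((n : ℤ) - (q + 1 : ℕ) : ℤ) : ℝ) + 1 = n - q := by push_cast; ring
    rw [this, div_pow N, div_pow N, one_div_pow]
    field_simp
    ring

/-- Termwise integration of `(N - u) ^ (-(q + 1))`, expanded in powers of `u / N`, against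
`u ^ (-(q + 1))`. On `[1, N / 2]` the series is dominated by its value at ratio `1 / 2`. -/
theorem hasSum_integral_half_inv_pow {N : ℝ} (hN : 2 ≤ N) (q : ℕ) :
    HasSum (fun n => antiderivCoeff q n * ((1 / 2) ^ n * 2 ^ q) * (N ^ (2 * q + 1))⁻¹
        - antiderivCoeff q n * (N ^ (q + 1 + n))⁻¹
        + if n = q then q.centralBinom * (N ^ (2 * q + 1))⁻¹ * Real.log (N / 2) else 0)
      (∫ u in (1 : ℝ)..N / 2, ((u * (N - u)) ^ (q + 1))⁻¹) := by
  simp only [← integral_choose_mul_pow hN]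
  have hN0 : (0 : ℝ) < N := by linarith
  have huI : ∀ u ∈ Set.uIoc 1 (N / 2), 1 < u ∧ u ≤ N / 2 := fun u hu => by
    rwa [Set.uIoc_of_le (by linarith)] at hu
  refine intervalIntegral.hasSum_integral_of_dominated_convergence
    (fun n _ => ((n + q).choose q : ℝ) * (1 / 2) ^ n) (fun n => ?_) (fun n => ?_) ?_ ?_ ?_
  · exact (by fun_prop : Measurable fun u : ℝ => ((n + q).choose q : ℝ) * (u / N) ^ n
      * (N ^ (q + 1))⁻¹ * (u ^ (q + 1))⁻¹).aestronglyMeasurable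
  · refine Filter.Eventually.of_forall fun u hu => ?_
    obtain ⟨h1, h2⟩ := huI u hu
    have hu0 : 0 < u := by linarith
    rw [Real.norm_of_nonneg (by positivity)]
    have ha : (u / N) ^ n ≤ (1 / 2) ^ n := by
      gcongr ?_ ^ n
      rw [div_le_div_iff₀ hN0 two_pos]; linarith
    have hb : (N ^ (q + 1))⁻¹ ≤ 1 := inv_le_one_of_one_le₀ (one_le_pow₀ (by linarith))
    have hc : (u ^ (q + 1))⁻¹ ≤ 1 := inv_le_one_of_one_le₀ (one_le_pow₀ h1.le)
    calc _ ≤ ((n + q).choose q : ℝ) * (1 / 2) ^ n * 1 * 1 := by gcongr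
      _ = _ := by ring
  · exact Filter.Eventually.of_forall fun u _ => summable_choose_mul_half_pow q
  · exact intervalIntegrable_const
  · refine Filter.Eventually.of_forall fun u hu => ?_
    obtain ⟨h1, h2⟩ := huI u hu
    have hu0 : 0 < u := by linarith
    have hlt : ‖u / N‖ < 1 := by
      rw [Real.norm_of_nonneg (by positivity), div_lt_one hN0]; linarith
    convert! ((hasSum_choose_mul_geometric_of_norm_lt_one q hlt).mul_right
      (N ^ (q + 1))⁻¹).mul_right (u ^ (q + 1))⁻¹ using 1
    have hs : 0 < N - u := by linarith
    rw [show 1 - u / N = (N - u) / N by field_simp, div_pow, mul_pow]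
    field_simp

theorem summable_antiderivCoeff_mul {N : ℝ} (hN : 2 ≤ N) (q : ℕ) :
    Summable fun n => antiderivCoeff q n * (N ^ (q + 1 + n))⁻¹ := by
  refine Summable.of_norm_bounded (summable_choose_mul_half_pow q) fun n => ?_
  have hN0 : (0 : ℝ) < N := by linarith
  rw [norm_mul, Real.norm_eq_abs, Real.norm_of_nonneg (by positivity)]
  have h2 : (N ^ (q + 1 + n))⁻¹ ≤ (1 / 2) ^ n := by
    rw [one_div, inv_pow]
    apply inv_anti₀ (by positivity)
    calc (2 : ℝ) ^ n ≤ N ^ n := by gcongr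
      _ ≤ N ^ (q + 1 + n) := pow_le_pow_right₀ (by linarith) (by omega)
  exact mul_le_mul (abs_antiderivCoeff_le q n) h2 (by positivity) (by positivity)

/-- The reflection `u ↦ N - u` reduces the integral to twice the integral over `[1, N / 2]`; the
terms in `log 2` then cancel. -/
theorem integral_inv_pow_eq {N : ℝ} (hN : 2 ≤ N) (q : ℕ) :
    ∫ u in (1 : ℝ)..N - 1, ((u * (N - u)) ^ (q + 1))⁻¹
      = 2 * (q.centralBinom * (N ^ (2 * q + 1))⁻¹
          * (Real.log N - ((harmonic (2 * q) : ℝ) - (harmonic q : ℝ)))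
        - ∑' n, antiderivCoeff q n * (N ^ (q + 1 + n))⁻¹) := by
  have hN0 : (0 : ℝ) < N := by linarith
  have hcont : ContinuousOn (fun u : ℝ => ((u * (N - u)) ^ (q + 1))⁻¹) (Set.Icc 1 (N - 1)) := by
    refine ContinuousOn.inv₀ (by fun_prop) fun u hu => ?_
    exact pow_ne_zero _ (mul_pos (by linarith [hu.1]) (by linarith [hu.2])).ne'
  have hint : ∀ a b : ℝ, a ∈ Set.Icc 1 (N - 1) → b ∈ Set.Icc 1 (N - 1) →
      IntervalIntegrable (fun u : ℝ => ((u * (N - u)) ^ (q + 1))⁻¹) MeasureTheory.volume a b :=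
    fun a b ha hb => (hcont.mono (Set.uIcc_subset_Icc ha hb)).intervalIntegrable
  have m1 : (1 : ℝ) ∈ Set.Icc 1 (N - 1) := ⟨le_rfl, by linarith⟩
  have m2 : N / 2 ∈ Set.Icc 1 (N - 1) := ⟨by linarith, by linarith⟩
  have m3 : N - 1 ∈ Set.Icc 1 (N - 1) := ⟨by linarith, le_rfl⟩
  rw [← intervalIntegral.integral_add_adjacent_intervals (hint _ _ m1 m2) (hint _ _ m2 m3)]
  have hrefl : ∫ u in N / 2..N - 1, ((u * (N - u)) ^ (q + 1))⁻¹
      = ∫ u in (1 : ℝ)..N / 2, ((u * (N - u)) ^ (q + 1))⁻¹ := by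
    have := intervalIntegral.integral_comp_sub_left
      (fun u : ℝ => ((u * (N - u)) ^ (q + 1))⁻¹) (a := 1) (b := N / 2) N
    rw [show N - N / 2 = N / 2 by ring] at this
    rw [← this]
    refine intervalIntegral.integral_congr fun u _ => ?_
    ring
  have h := (((hasSum_antiderivCoeff_half q).mul_right (N ^ (2 * q + 1))⁻¹).sub
    (summable_antiderivCoeff_mul hN q).hasSum).add
    (hasSum_ite_eq q (q.centralBinom * (N ^ (2 * q + 1))⁻¹ * Real.log (N / 2)))
  rw [hrefl, (hasSum_integral_half_inv_pow hN q).unique h, Real.log_div hN0.ne' two_ne_zero]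
  ring

/-! ### Termwise integration of the product and summation over `N` -/

theorem summable_inv_add_one_pow {q : ℕ} (hq : 1 ≤ q) :
    Summable fun k : ℕ => (((k : ℝ) + 1) ^ (q + 1))⁻¹ := by
  have h := (summable_nat_add_iff 1).2
    ((Real.summable_nat_pow_inv (p := q + 1)).2 (by omega))
  simpa using h

theorem inv_add_one_add_pow_le (q k : ℕ) {x : ℝ} (hx : 0 ≤ x) :
    (((k : ℝ) + 1 + x) ^ (q + 1))⁻¹ ≤ (((k : ℝ) + 1) ^ (q + 1))⁻¹ := by
  exact inv_anti₀ (by positivity) (pow_le_pow_left₀ (by positivity) (by linarith) _)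

theorem summable_inv_add_one_add_pow {q : ℕ} (hq : 1 ≤ q) {x : ℝ} (hx : 0 ≤ x) :
    Summable fun k : ℕ => (((k : ℝ) + 1 + x) ^ (q + 1))⁻¹ :=
  Summable.of_nonneg_of_le (fun k => by positivity) (fun k => inv_add_one_add_pow_le q k hx)
    (summable_inv_add_one_pow hq)

theorem continuousOn_tsum_inv_pow {q : ℕ} (hq : 1 ≤ q) :
    ContinuousOn (fun x : ℝ => ∑' k : ℕ, (((k : ℝ) + 1 + x) ^ (q + 1))⁻¹) (Set.Ici 0) := by
  refine continuousOn_tsum (fun k => ?_) (summable_inv_add_one_pow hq) fun k x hx => ?_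
  · refine ContinuousOn.inv₀ (by fun_prop) fun x hx => ?_
    have : (0 : ℝ) ≤ x := hx
    positivity
  · have hx' : (0 : ℝ) ≤ x := hx
    rw [Real.norm_of_nonneg (by positivity)]
    exact inv_add_one_add_pow_le q k hx'

/-- For `j + k = M` the substitution `u = j + 1 + x` turns the product of the terms of index `j` and
`k` into `(u (M + 3 - u)) ^ (-(q + 1))` on `[j + 1, j + 2]`, and these intervals tile
`[1, M + 2]`. -/
theorem sum_antidiagonal_integral (q M : ℕ) :
    ∑ p ∈ Finset.HasAntidiagonal.antidiagonal M, ∫ x in (0 : ℝ)..1,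
        (((p.1 : ℝ) + 1 + x) ^ (q + 1))⁻¹ * (((p.2 : ℝ) + 1 + (1 - x)) ^ (q + 1))⁻¹
      = ∫ u in (1 : ℝ)..(M + 3 : ℝ) - 1, ((u * ((M + 3 : ℝ) - u)) ^ (q + 1))⁻¹ := by
  rw [Finset.Nat.sum_antidiagonal_eq_sum_range_succ (fun i j : ℕ => ∫ x in (0 : ℝ)..1,
        (((i : ℝ) + 1 + x) ^ (q + 1))⁻¹ * (((j : ℝ) + 1 + (1 - x)) ^ (q + 1))⁻¹)]
  have hterm : ∀ k ∈ Finset.range M.succ, (∫ x in (0 : ℝ)..1,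
        (((k : ℝ) + 1 + x) ^ (q + 1))⁻¹ * ((((M - k : ℕ) : ℝ) + 1 + (1 - x)) ^ (q + 1))⁻¹)
      = ∫ u in ((k : ℝ) + 1)..((k + 1 : ℕ) : ℝ) + 1, ((u * ((M + 3 : ℝ) - u)) ^ (q + 1))⁻¹ := by
    intro k hk
    have h := intervalIntegral.integral_comp_add_right
      (fun u : ℝ => ((u * ((M + 3 : ℝ) - u)) ^ (q + 1))⁻¹) (a := 0) (b := 1) ((k : ℝ) + 1)
    rw [show (0 : ℝ) + (k + 1) = k + 1 by ring,
      show (1 : ℝ) + (k + 1) = ((k + 1 : ℕ) : ℝ) + 1 by push_cast; ring] at h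
    rw [← h]
    refine intervalIntegral.integral_congr fun x _ => ?_
    rw [Nat.cast_sub (Nat.lt_succ_iff.1 (Finset.mem_range.1 hk))]
    rw [← mul_inv, ← mul_pow]
    congr 2
    ring
  rw [Finset.sum_congr rfl hterm,
    intervalIntegral.sum_integral_adjacent_intervals (a := fun k : ℕ => (k : ℝ) + 1)]
  · congr 1
    · simp
    · push_cast; ring
  · intro k hk
    refine ContinuousOn.intervalIntegrable (ContinuousOn.inv₀ (by fun_prop) fun u hu => ?_)
    have hkM : (k : ℝ) + 1 ≤ M + 1 := by exact_mod_cast hk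
    rw [Set.uIcc_of_le (by push_cast; linarith)] at hu
    have h1 := hu.1
    have h2 := hu.2
    push_cast at h2
    have h0 : (0 : ℝ) ≤ k := by positivity
    exact pow_ne_zero _ (mul_pos (by linarith) (by linarith)).ne'

/-- Multiplying out the two series, integrating termwise and grouping the pairs of indices by their
sum. -/
theorem hasSum_integral_inv_pow {q : ℕ} (hq : 1 ≤ q) :
    HasSum (fun M : ℕ => ∫ u in (1 : ℝ)..(M + 3 : ℝ) - 1, ((u * ((M + 3 : ℝ) - u)) ^ (q + 1))⁻¹)
      (∫ x in (0 : ℝ)..1, (∑' k : ℕ, (((k : ℝ) + 1 + x) ^ (q + 1))⁻¹) *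
        ∑' k : ℕ, (((k : ℝ) + 1 + (1 - x)) ^ (q + 1))⁻¹) := by
  have hxI : ∀ x ∈ Set.uIoc (0 : ℝ) 1, 0 ≤ x ∧ 0 ≤ 1 - x := fun x hx => by
    rw [Set.uIoc_of_le zero_le_one] at hx
    exact ⟨hx.1.le, by linarith [hx.2]⟩
  have hsq := (summable_inv_add_one_pow hq).mul_of_nonneg (summable_inv_add_one_pow hq)
    (fun k => by positivity) (fun k => by positivity)
  have hpairs : HasSum (fun p : ℕ × ℕ => ∫ x in (0 : ℝ)..1,
        (((p.1 : ℝ) + 1 + x) ^ (q + 1))⁻¹ * (((p.2 : ℝ) + 1 + (1 - x)) ^ (q + 1))⁻¹)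
      (∫ x in (0 : ℝ)..1, (∑' k : ℕ, (((k : ℝ) + 1 + x) ^ (q + 1))⁻¹) *
        ∑' k : ℕ, (((k : ℝ) + 1 + (1 - x)) ^ (q + 1))⁻¹) := by
    refine intervalIntegral.hasSum_integral_of_dominated_convergence
      (fun p _ => (((p.1 : ℝ) + 1) ^ (q + 1))⁻¹ * (((p.2 : ℝ) + 1) ^ (q + 1))⁻¹)
      (fun p => ?_) (fun p => ?_) ?_ ?_ ?_
    · exact (by fun_prop : Measurable fun x : ℝ => (((p.1 : ℝ) + 1 + x) ^ (q + 1))⁻¹ *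
        (((p.2 : ℝ) + 1 + (1 - x)) ^ (q + 1))⁻¹).aestronglyMeasurable
    · refine Filter.Eventually.of_forall fun x hx => ?_
      obtain ⟨h0, h1⟩ := hxI x hx
      rw [Real.norm_of_nonneg (by positivity)]
      exact mul_le_mul (inv_add_one_add_pow_le q _ h0) (inv_add_one_add_pow_le q _ h1)
        (by positivity) (by positivity)
    · exact Filter.Eventually.of_forall fun x _ => hsq
    · exact intervalIntegrable_const
    · refine Filter.Eventually.of_forall fun x hx => ?_
      obtain ⟨h0, h1⟩ := hxI x hx
      have s0 := summable_inv_add_one_add_pow hq h0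
      have s1 := summable_inv_add_one_add_pow hq h1
      exact s0.hasSum.mul s1.hasSum
        (s0.mul_of_nonneg s1 (fun k => by positivity) (fun k => by positivity))
  have hsig := (Finset.HasAntidiagonal.sigmaAntidiagonalEquivProd.hasSum_iff.2 hpairs).sigma
    (fun M => hasSum_fintype _)
  convert! hsig using 1
  ext M
  rw [← sum_antidiagonal_integral]
  exact (Finset.sum_coe_sort (Finset.HasAntidiagonal.antidiagonal M) _).symm

theorem summable_inv_add_two_pow {k : ℕ} (hk : 2 ≤ k) :
    Summable fun N : ℕ => (((N : ℝ) + 2) ^ k)⁻¹ := by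
  simpa using (summable_nat_add_iff 2).2 ((Real.summable_nat_pow_inv (p := k)).2 (by omega))

theorem summable_antiderivCoeff_mul_inv_pow {q : ℕ} (hq : 1 ≤ q) :
    Summable fun p : ℕ × ℕ => antiderivCoeff q p.2 * (((p.1 : ℝ) + 2) ^ (q + 1 + p.2))⁻¹ := by
  have hs := (summable_inv_add_two_pow (by omega : 2 ≤ q + 1)).mul_of_nonneg
    (summable_choose_mul_half_pow q) (fun N => by positivity) (fun n => by positivity)
  refine Summable.of_norm_bounded hs fun p => ?_
  rw [norm_mul, Real.norm_eq_abs, Real.norm_of_nonneg (by positivity), pow_add, mul_inv]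
  have h2 : (((p.1 : ℝ) + 2) ^ p.2)⁻¹ ≤ (1 / 2) ^ p.2 := by
    rw [one_div, inv_pow]
    apply inv_anti₀ (by positivity)
    gcongr
    linarith [(Nat.cast_nonneg p.1 : (0 : ℝ) ≤ p.1)]
  calc _ ≤ ((p.2 + q).choose q : ℝ) * ((((p.1 : ℝ) + 2) ^ (q + 1))⁻¹ * (1 / 2) ^ p.2) := by
        gcongr
        exact abs_antiderivCoeff_le q p.2
    _ = _ := by ring

theorem integral_tsum_mul_tsum {q : ℕ} (hq : 1 ≤ q) {L : ℝ}
    (hL : HasSum (fun N : ℕ => Real.log ((N : ℝ) + 2) * (((N : ℝ) + 2) ^ (2 * q + 1))⁻¹) L) :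
    Summable (fun n => antiderivCoeff q n * ∑' N : ℕ, (((N : ℝ) + 2) ^ (q + 1 + n))⁻¹) ∧
    (∫ x in (0 : ℝ)..1, (∑' k : ℕ, (((k : ℝ) + 1 + x) ^ (q + 1))⁻¹) *
        ∑' k : ℕ, (((k : ℝ) + 1 + (1 - x)) ^ (q + 1))⁻¹)
      = 2 * (q.centralBinom * (L - ((harmonic (2 * q) : ℝ) - (harmonic q : ℝ)) *
          ∑' N : ℕ, (((N : ℝ) + 2) ^ (2 * q + 1))⁻¹)
        - ∑' n, antiderivCoeff q n * ∑' N : ℕ, (((N : ℝ) + 2) ^ (q + 1 + n))⁻¹) := by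
  have hdouble := summable_antiderivCoeff_mul_inv_pow hq
  have hrow : ∀ n, HasSum (fun N : ℕ => antiderivCoeff q n * (((N : ℝ) + 2) ^ (q + 1 + n))⁻¹)
      (antiderivCoeff q n * ∑' N : ℕ, (((N : ℝ) + 2) ^ (q + 1 + n))⁻¹) := fun n =>
    (summable_inv_add_two_pow (by omega)).hasSum.mul_left _
  have hswap := ((Equiv.prodComm ℕ ℕ).hasSum_iff.2 hdouble.hasSum).prod_fiberwise hrow
  have hN2 : ∀ N : ℕ, (2 : ℝ) ≤ (N : ℝ) + 2 := fun N => by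
    linarith [(Nat.cast_nonneg N : (0 : ℝ) ≤ N)]
  have hcol := hdouble.hasSum.prod_fiberwise fun N =>
    (summable_antiderivCoeff_mul (hN2 N) q).hasSum
  refine ⟨hswap.summable, ?_⟩
  have hA : HasSum (fun N : ℕ =>
      ∫ u in (1 : ℝ)..((N : ℝ) + 2) - 1, ((u * (((N : ℝ) + 2) - u)) ^ (q + 1))⁻¹)
      (∫ x in (0 : ℝ)..1, (∑' k : ℕ, (((k : ℝ) + 1 + x) ^ (q + 1))⁻¹) *
        ∑' k : ℕ, (((k : ℝ) + 1 + (1 - x)) ^ (q + 1))⁻¹) := by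
    rw [← hasSum_nat_add_iff' 1]
    convert! hasSum_integral_inv_pow hq using 1
    · ext M
      rw [show ((M + 1 : ℕ) : ℝ) + 2 = M + 3 by push_cast; ring]
    -- For `N = 0` the interval is `[1, 1]`.
    · norm_num
  have hB := (((hL.sub ((summable_inv_add_two_pow (by omega : 2 ≤ 2 * q + 1)).hasSum.mul_left
    ((harmonic (2 * q) : ℝ) - (harmonic q : ℝ)))).mul_left (q.centralBinom : ℝ)).sub
      hcol).mul_left 2
  rw [hswap.tsum_eq]
  refine hA.unique ?_
  convert! hB using 1
  ext N
  rw [integral_inv_pow_eq (hN2 N)]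
  ring

/-! ### Values of `ζ`, `ζ'`, `ψ` and `ζ₁` at integers -/

theorem riemannZeta_natCast_sub_one {k : ℕ} (hk : 2 ≤ k) :
    riemannZeta k - 1 = ((∑' N : ℕ, (((N : ℝ) + 2) ^ k)⁻¹ : ℝ) : ℂ) := by
  have hs : Summable fun n : ℕ => 1 / (n : ℂ) ^ k := by
    simpa using Complex.summable_ofReal.2 (Real.summable_nat_pow_inv.2 (by omega : 1 < k))
  rw [zeta_nat_eq_tsum_of_gt_one (by omega), ← hs.sum_add_tsum_nat_add 2, Complex.ofReal_tsum]
  simp [Finset.sum_range_succ, show k ≠ 0 by omega]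

/-- Termwise differentiation of the Dirichlet series of `ζ` at an integer `k ≥ 2`, with the terms of
index `0` and `1`, both zero, dropped. The existential records the convergence over `ℝ`. -/
theorem hasSum_log_mul_inv_pow {k : ℕ} (hk : 2 ≤ k) :
    ∃ L : ℝ, HasSum (fun N : ℕ => Real.log ((N : ℝ) + 2) * (((N : ℝ) + 2) ^ k)⁻¹) L ∧
      (L : ℂ) = -deriv riemannZeta k := by
  have hre : 1 < (k : ℂ).re := by
    rw [Complex.natCast_re]; exact_mod_cast hk
  have habs : LSeries.abscissaOfAbsConv 1 < (k : ℂ).re := by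
    rw [LSeries.abscissaOfAbsConv_one]; exact_mod_cast hre
  have hder : deriv riemannZeta k = deriv (LSeries 1) k := by
    refine Filter.EventuallyEq.deriv_eq ?_
    filter_upwards [(isOpen_lt continuous_const Complex.continuous_re).mem_nhds hre] with s hs
    exact (LSeries_one_eq_riemannZeta hs).symm
  have hs := (LSeriesSummable_logMul_of_lt_re habs).LSeriesHasSum
  rw [LSeriesHasSum, ← hasSum_nat_add_iff' 2] at hs
  have hterm : (fun N : ℕ => LSeries.term (LSeries.logMul 1) k (N + 2))
      = fun N : ℕ => ((Real.log ((N : ℝ) + 2) * (((N : ℝ) + 2) ^ k)⁻¹ : ℝ) : ℂ) := by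
    ext N
    rw [LSeries.term_of_ne_zero (by omega)]
    push_cast [LSeries.logMul, Complex.ofReal_log (by positivity : (0 : ℝ) ≤ (N : ℝ) + 2)]
    simp [div_eq_mul_inv]
  rw [hterm] at hs
  obtain ⟨L, hL⟩ := Complex.summable_ofReal.1 hs.summable
  refine ⟨L, hL, ?_⟩
  rw [(Complex.hasSum_ofReal.2 hL).unique hs, hder, LSeries_deriv habs]
  simp [Finset.sum_range_succ, LSeries.term, LSeries.logMul]

theorem digamma_natCast_add_one (n : ℕ) :
    Complex.digamma (n + 1) = ((harmonic n : ℝ) : ℂ) - Real.eulerMascheroniConstant := by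
  induction n with
  | zero => simp [Complex.digamma_one]
  | succ n ih =>
    rw [Complex.digamma_apply_add_one _ fun m h => ?_, Nat.cast_succ, ih, harmonic_succ]
    · push_cast; ring
    · have : ((n + 1 + m : ℕ) : ℂ) = 0 := by push_cast at h ⊢; rw [h]; ring
      exact absurd (Nat.cast_eq_zero.1 this) (by omega)

theorem auxHurwitzZeta_natCast {q : ℕ} (hq : 1 ≤ q) {x : ℝ} (hx : x ∈ Set.Icc (0 : ℝ) 1) :
    auxHurwitzZeta ((q + 1 : ℕ) : ℂ) x
      = ((∑' k : ℕ, (((k : ℝ) + 1 + x) ^ (q + 1))⁻¹ : ℝ) : ℂ) := by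
  have h1 : 1 < ((q + 1 : ℕ) : ℂ).re := by
    rw [Complex.natCast_re]; exact_mod_cast Nat.lt_succ_of_le hq
  rw [← (hasSum_auxHurwitzZeta h1 hx).tsum_eq, Complex.ofReal_tsum]
  refine tsum_congr fun k => ?_
  rw [Complex.cpow_natCast]
  push_cast
  rw [one_div]

theorem primedTerm_succ {q : ℕ} (hq : 1 ≤ q) (n : ℕ) :
    primedTerm (q + 1) n
      = ((antiderivCoeff q n * ∑' N : ℕ, (((N : ℝ) + 2) ^ (q + 1 + n))⁻¹ : ℝ) : ℂ) := by
  rcases eq_or_ne n q with rfl | h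
  · simp [primedTerm, antiderivCoeff_self]
  · have hc : (ascPochhammer ℂ n).eval ((q + 1 : ℕ) : ℂ) / (n ! : ℂ) = ((n + q).choose q : ℂ) := by
      rw [ascPochhammer_nat_eq_natCast_ascFactorial, Nat.ascFactorial_eq_factorial_mul_choose,
        Nat.cast_mul, mul_div_cancel_left₀ _ (by exact_mod_cast n.factorial_ne_zero), add_comm q n,
        Nat.choose_symm_add]
    have hz := riemannZeta_natCast_sub_one (show 2 ≤ q + 1 + n by omega)
    rw [primedTerm, if_neg (by omega), hc,
      show (n : ℂ) + ((q + 1 : ℕ) : ℂ) = ((q + 1 + n : ℕ) : ℂ) by push_cast; ring, hz,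
      antiderivCoeff_of_ne h, Complex.ofReal_mul, Complex.ofReal_div,
      show (n : ℂ) + 1 - ((q + 1 : ℕ) : ℂ) = n - q by push_cast; ring]
    push_cast
    ring

theorem theorem4 (m : ℕ) (hm : 2 ≤ m) :
    IntervalIntegrable
      (fun x : ℝ => auxHurwitzZeta (m : ℂ) x * auxHurwitzZeta (m : ℂ) (1 - x))
      MeasureTheory.volume 0 1 ∧
    Summable (fun n : ℕ => primedTerm m n) ∧
    (∫ x in (0 : ℝ)..1, auxHurwitzZeta (m : ℂ) x * auxHurwitzZeta (m : ℂ) (1 - x)) =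
      2 * Complex.Gamma (2 * (m : ℂ) - 1) / Complex.Gamma (m : ℂ) ^ 2 *
        ((Complex.digamma (m : ℂ) - Complex.digamma (2 * (m : ℂ) - 1)) *
            (riemannZeta (2 * (m : ℂ) - 1) - 1)
          - deriv riemannZeta (2 * (m : ℂ) - 1))
      - 2 * ∑' n : ℕ, primedTerm m n := by
  obtain ⟨q, rfl⟩ : ∃ q, m = q + 1 := ⟨m - 1, by omega⟩
  have hq : 1 ≤ q := by omega
  have hcongr : ∀ x ∈ Set.uIcc (0 : ℝ) 1,
      auxHurwitzZeta ((q + 1 : ℕ) : ℂ) x * auxHurwitzZeta ((q + 1 : ℕ) : ℂ) (1 - x)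
      = (((∑' k : ℕ, (((k : ℝ) + 1 + x) ^ (q + 1))⁻¹) *
          ∑' k : ℕ, (((k : ℝ) + 1 + (1 - x)) ^ (q + 1))⁻¹ : ℝ) : ℂ) := fun x hx => by
    rw [Set.uIcc_of_le zero_le_one] at hx
    rw [auxHurwitzZeta_natCast hq hx,
      auxHurwitzZeta_natCast hq ⟨by linarith [hx.2], by linarith [hx.1]⟩, ← Complex.ofReal_mul]
  obtain ⟨L, hL, hLz⟩ := hasSum_log_mul_inv_pow (show 2 ≤ 2 * q + 1 by omega)
  obtain ⟨hsum, hint⟩ := integral_tsum_mul_tsum hq hL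
  refine ⟨?_, ?_, ?_⟩
  · refine ContinuousOn.intervalIntegrable (ContinuousOn.congr ?_ hcongr)
    rw [Set.uIcc_of_le zero_le_one]
    have hc := continuousOn_tsum_inv_pow hq
    refine Complex.continuous_ofReal.comp_continuousOn (ContinuousOn.mul ?_ ?_)
    · exact hc.mono fun x hx => hx.1
    · exact hc.comp (by fun_prop : ContinuousOn (fun x : ℝ => 1 - x) (Set.Icc 0 1))
        fun x hx => sub_nonneg.2 hx.2
  · simp only [primedTerm_succ hq]
    exact Complex.summable_ofReal.2 hsum
  · rw [intervalIntegral.integral_congr hcongr, intervalIntegral.integral_ofReal, hint]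
    simp only [primedTerm_succ hq]
    rw [← Complex.ofReal_tsum,
      show 2 * ((q + 1 : ℕ) : ℂ) - 1 = ((2 * q + 1 : ℕ) : ℂ) by push_cast; ring,
      riemannZeta_natCast_sub_one (by omega), sub_eq_add_neg _ (deriv _ _), ← hLz]
    have hG1 : Complex.Gamma ((q + 1 : ℕ) : ℂ) = (q ! : ℂ) := by
      rw [Nat.cast_succ, Complex.Gamma_nat_eq_factorial]
    have hG2 : Complex.Gamma ((2 * q + 1 : ℕ) : ℂ) = ((2 * q)! : ℂ) := by
      rw [Nat.cast_succ, Complex.Gamma_nat_eq_factorial]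
    have hb : ((2 * q)! : ℂ) / (q ! : ℂ) ^ 2 = q.centralBinom := by
      rw [Nat.centralBinom, two_mul, Nat.cast_add_choose, sq]
    rw [hG1, hG2, mul_div_assoc, hb, Nat.cast_succ, Nat.cast_succ, digamma_natCast_add_one,
      digamma_natCast_add_one]
    push_cast
    ring
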